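/- Let $B$ be a path connected, locally path connected and semilocally simply connected space with base point $b_0$, let $G=\pi_1(B,b_0)$, and let $\widetilde B\to B$ be the universal covering, whose points are the homotopy classes $[\alpha]$ of paths $\alpha$ starting at $b_0$; $G$ acts on $\widetilde B$ by $[\gamma]\cdot[\alpha]=[\gamma*\alpha]$. A *locally constant bundle* over $B$ with fibre $F$ is a locally trivial bundle $p:E\to B$ with fibre $F$ together with a homeomorphism $\Phi:\widetilde E=E\times_B\widetilde B\to F\times\widetilde B$ over $\widetilde B$ (a trivialization of the pull-back) whose transition functions are constant: for every $g\in G$ there is a map $\rho_g:F\to F$ such that, if $\Phi(e,a)=(x,a)$, then $\Phi(e,g\cdot a)=(\rho_g(x),g\cdot a)$. A continuous map $f:E_1\to E_2$ over $B$ between locally constant bundles is *locally constant* if there is a continuous map $h:F_1\to F_2$ such that the induced map $F_1\times\widetilde B\cong\widetilde E_1\to\widetilde E_2\cong F_2\times\widetilde B$ is $(x,a)\mapsto(h(x),a)$. A *locally constant sub-bundle* of $E$ is a subspace $R\subset E$ such that $R\to B$ has a structure of locally constant bundle for which the inclusion $R\to E$ is locally constant. The product $E\times_BE\to B$ is a locally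 constant bundle with fibre $F\times F$, trivialized by $\Phi$ in each factor. The group $G$, with the product given by concatenation of loops, acts on the right on the fibre $X=p^{-1}(b_0)$ by homeomorphisms: if $\Phi(e,[\mathrm{const}])=(x,[\mathrm{const}])$, then $e\cdot[\gamma]$ is the point of $X$ with $\Phi(e\cdot[\gamma],[\gamma])=(x,[\gamma])$, that is, the end of the lift of $\gamma$ that starts at $e$ and has constant $F$-coordinate. A relation $R$ *satisfies the axioms of a strict total order* on a product $P$ ($P=E\times_BE$ or $P=X\times X$) with diagonal $\Delta$ if $R\subset P$, $R\circ R\subset R$, $\Delta\cap R=\emptyset$, $R\cap R^{op}=\emptyset$ and $R\cup R^{op}=P\setminus\Delta$. The locally constant bundle $p:E\to B$ is *orderable* if there is a locally constant sub-bundle $R\subset E\times_BE$ that satisfies these axioms; the $G$-space $X$ is *orderable* if there is a $G$-invariant subspace $R\subset X\times X$ that satisfies them. **Proposition.** Let $p:E\to B$ be a locally constant bundle and $X$ its fibre over $b_0$. Then $p:E\to B$ is orderable as a bundle if and only if $X$ is orderable as a $G$-space. -/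

import Mathlib

open Topology

/-! ### The universal covering space -/

/-- A space is semilocally simply connected if every point `b` has a neighbourhood `U` such that
every loop at `b` inside `U` is null-homotopic in the whole space. -/
class SemilocallySimplyConnectedSpace (B : Type*) [TopologicalSpace B] : Prop where
  exists_nhds : ∀ b : B, ∃ U ∈ 𝓝 b, ∀ γ : Path b b, (∀ t, γ t ∈ U) → γ.Homotopic (Path.refl b)

/-- The points of the universal covering space of `(B, b₀)`: homotopy classes, relative to the
endpoints, of paths that start at `b₀`. -/
structure UniversalCover {B : Type*} [TopologicalSpace B] (b₀ : B) where
  /-- The covering map `[α] ↦ α(1)`. -/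
  proj : B
  /-- The homotopy class of the path. -/
  cls : Path.Homotopic.Quotient b₀ proj

namespace UniversalCover

variable {B : Type*} [TopologicalSpace B] {b₀ : B}

/-- The set of classes `[α * η]`, where `[α]` is given and `η` is a path inside `U`. -/
def basicNhd (a : UniversalCover b₀) (U : Set B) : Set (UniversalCover b₀) :=
  {c | ∃ η : Path a.proj c.proj, (∀ t, η t ∈ U) ∧
    c.cls = a.cls.trans (Path.Homotopic.Quotient.mk η)}

/-- The usual topology of the universal covering space: the sets `basicNhd a U` with `U` open
form a basis. -/
instance : TopologicalSpace (UniversalCover b₀) :=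
  TopologicalSpace.generateFrom {N | ∃ (a : UniversalCover b₀) (U : Set B),
    IsOpen U ∧ N = basicNhd a U}

/-- The point of the universal cover given by an element of the fundamental group. -/
def ofLoop (g : FundamentalGroup B b₀) : UniversalCover b₀ := ⟨b₀, FundamentalGroup.toPath g⟩

/-- The deck transformation `[α] ↦ [γ * α]` given by `g = [γ]` (`trans` is concatenation:
first `γ`, then `α`). -/
noncomputable def deck (g : FundamentalGroup B b₀) (a : UniversalCover b₀) : UniversalCover b₀ :=
  ⟨a.proj, (FundamentalGroup.toPath g).trans a.cls⟩

end UniversalCover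

/-! ### Locally constant bundles -/

/-- `p` is a locally trivial bundle with fibre `F`. -/
def IsLocallyTrivialBundle {B E : Type*} (F : Type*) [TopologicalSpace B] [TopologicalSpace E]
    [TopologicalSpace F] (p : E → B) : Prop :=
  Continuous p ∧ ∀ b : B, ∃ U : Set B, IsOpen U ∧ b ∈ U ∧
    IsHomeomorphicTrivialFiberBundle F (U.restrictPreimage p)

/-- A locally constant bundle with projection `p : E → B` and fibre `F`: a locally trivial bundle
together with a trivialization `Φ : Ẽ ≃ F × B̃` over `B̃` of its pull-back `Ẽ = E ×_B B̃` to the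
universal cover. The trivialization is what the notion of a locally constant map refers to. The
last field says that the transition functions are constant: the charts of `E` obtained from `Φ`
and from local sections of `B̃ → B` differ by deck transformations, and each deck transformation
`g` acts on `F × B̃` through a self-map `ρ` of `F` that does not depend on the point of `B̃`. -/
structure LocallyConstantBundle {B E : Type*} [TopologicalSpace B] [TopologicalSpace E]
    (b₀ : B) (F : Type*) [TopologicalSpace F] (p : E → B) where
  locallyTrivial : IsLocallyTrivialBundle F p
  /-- The trivialization of the pull-back to the universal cover. -/
  Φ : p.Pullback (UniversalCover.proj (b₀ := b₀)) ≃ₜ F × UniversalCover b₀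
  Φ_snd : ∀ z, (Φ z).2 = z.1.2
  constant_transition : ∀ g : FundamentalGroup B b₀, ∃ ρ : F → F,
    ∀ (e : E) (a : UniversalCover b₀) (h : p e = a.proj),
      (Φ ⟨(e, UniversalCover.deck g a), h⟩).1 = ρ (Φ ⟨(e, a), h⟩).1

/-- A continuous map `f : E₁ → E₂` over `B` is locally constant if the induced map
`F₁ × B̃ ≃ Ẽ₁ → Ẽ₂ ≃ F₂ × B̃` is `(x, a) ↦ (g x, a)` for a continuous map `g`. -/
def IsLocallyConstantMap {B E₁ E₂ F₁ F₂ : Type*} [TopologicalSpace B] [TopologicalSpace E₁]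
    [TopologicalSpace E₂] [TopologicalSpace F₁] [TopologicalSpace F₂] {b₀ : B}
    {p₁ : E₁ → B} {p₂ : E₂ → B} (L₁ : LocallyConstantBundle b₀ F₁ p₁)
    (L₂ : LocallyConstantBundle b₀ F₂ p₂) (f : E₁ → E₂) : Prop :=
  Continuous f ∧ ∃ hf : ∀ e, p₂ (f e) = p₁ e, ∃ g : F₁ → F₂, Continuous g ∧
    ∀ z : p₁.Pullback (UniversalCover.proj (b₀ := b₀)),
      L₂.Φ ⟨(f z.1.1, z.1.2), (hf _).trans z.2⟩ = (g (L₁.Φ z).1, z.1.2)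

namespace LocallyConstantBundle

universe u v w

variable {B : Type u} {E : Type v} {F : Type w} [TopologicalSpace B] [TopologicalSpace E]
  [TopologicalSpace F] {b₀ : B} {p : E → B}

/-- A locally constant sub-bundle: a subspace `R` of `E` such that `R → B` carries a structure of
locally constant bundle for which the inclusion `R → E` is a locally constant map. -/
def IsSubbundle (L : LocallyConstantBundle b₀ F p) (R : Set E) : Prop :=
  ∃ (F' : Type w) (_ : TopologicalSpace F')
    (L' : LocallyConstantBundle b₀ F' (fun e : R => p e)),
      IsLocallyConstantMap L' L (Subtype.val : R → E)

theorem symm_snd (L : LocallyConstantBundle b₀ F p) (x : F) (a : UniversalCover b₀) :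
    (L.Φ.symm (x, a)).1.2 = a := by
  rw [← L.Φ_snd, Homeomorph.apply_symm_apply]

theorem proj_symm (L : LocallyConstantBundle b₀ F p) (x : F) (a : UniversalCover b₀) :
    p (L.Φ.symm (x, a)).1.1 = a.proj :=
  (L.Φ.symm (x, a)).2.trans (by rw [L.symm_snd])

theorem apply_symm_fst (L : LocallyConstantBundle b₀ F p) (x : F) (a : UniversalCover b₀) :
    L.Φ ⟨((L.Φ.symm (x, a)).1.1, a), L.proj_symm x a⟩ = (x, a) := by
  have h : (⟨((L.Φ.symm (x, a)).1.1, a), L.proj_symm x a⟩ :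
      p.Pullback (UniversalCover.proj (b₀ := b₀))) = L.Φ.symm (x, a) :=
    Subtype.ext (Prod.ext rfl (L.symm_snd x a).symm)
  rw [h, Homeomorph.apply_symm_apply]

theorem coord_symm (L : LocallyConstantBundle b₀ F p) (x : F) (a : UniversalCover b₀) :
    (L.Φ ⟨((L.Φ.symm (x, a)).1.1, a), L.proj_symm x a⟩).1 = x := by
  rw [apply_symm_fst]

theorem symm_apply_fst (L : LocallyConstantBundle b₀ F p) (e : E) (a : UniversalCover b₀)
    (h : p e = a.proj) : (L.Φ.symm ((L.Φ ⟨(e, a), h⟩).1, a)).1.1 = e := by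
  have h' : ((L.Φ ⟨(e, a), h⟩).1, a) = L.Φ ⟨(e, a), h⟩ := Prod.ext rfl (L.Φ_snd ⟨(e, a), h⟩).symm
  rw [h', Homeomorph.symm_apply_apply]

/-! #### The fibre as a space with an action of the fundamental group -/

/-- The fibre of the bundle over the base point. -/
def Fibre (_ : LocallyConstantBundle b₀ F p) : Type v := {e : E // p e = b₀}

instance (L : LocallyConstantBundle b₀ F p) : TopologicalSpace L.Fibre :=
  inferInstanceAs (TopologicalSpace {e : E // p e = b₀})

/-- `L.transport e g` is the end point `e · [γ]` of the horizontal lift of the loop `γ`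
(`g = [γ]`) that starts at `e`. Horizontal means that the `F`-coordinate given by the
trivialization is constant along the lift: at the class of the constant loop it is that of `e`,
and the end point has the same coordinate at the class of `γ`. -/
noncomputable def transport (L : LocallyConstantBundle b₀ F p) (e : L.Fibre) (g : FundamentalGroup B b₀) :
    L.Fibre :=
  ⟨(L.Φ.symm ((L.Φ ⟨(e.1, UniversalCover.ofLoop 1), e.2⟩).1, UniversalCover.ofLoop g)).1.1,
    L.proj_symm _ _⟩

theorem coord_transport (L : LocallyConstantBundle b₀ F p) (e : L.Fibre)
    (g : FundamentalGroup B b₀) :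
    (L.Φ ⟨((L.transport e g).1, UniversalCover.ofLoop g), (L.transport e g).2⟩).1 =
      (L.Φ ⟨(e.1, UniversalCover.ofLoop 1), e.2⟩).1 :=
  L.coord_symm _ _

theorem fibre_ext (L : LocallyConstantBundle b₀ F p) {x y : L.Fibre}
    (g : FundamentalGroup B b₀)
    (h : (L.Φ ⟨(x.1, UniversalCover.ofLoop g), x.2⟩).1 =
      (L.Φ ⟨(y.1, UniversalCover.ofLoop g), y.2⟩).1) : x = y := by
  have hx := L.symm_apply_fst x.1 (UniversalCover.ofLoop g) x.2
  have hy := L.symm_apply_fst y.1 (UniversalCover.ofLoop g) y.2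
  rw [h] at hx
  exact Subtype.ext (hx.symm.trans hy)

theorem deck_ofLoop (g h : FundamentalGroup B b₀) :
    UniversalCover.deck g (UniversalCover.ofLoop h) = UniversalCover.ofLoop (h * g) := rfl

/-- The action of the fundamental group on the fibre, `g • e = e · [γ]` for `g = [γ]`. The product
`g * h` in `FundamentalGroup B b₀` is the class of the concatenation "first `h`, then `g`", so a
left action of this group is precisely a right action of the group of classes of loops with the
product given by concatenation in the order of writing. -/
noncomputable instance (L : LocallyConstantBundle b₀ F p) : MulAction (FundamentalGroup B b₀) L.Fibre where
  smul g e := L.transport e g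
  one_smul e := L.fibre_ext 1 (L.coord_transport e 1)
  mul_smul g h e := by
    obtain ⟨ρ, hρ⟩ := L.constant_transition h
    refine L.fibre_ext (g * h) ?_
    refine (L.coord_transport e (g * h)).trans ?_
    have h1 := hρ (L.transport (L.transport e h) g).1 (UniversalCover.ofLoop g)
      (L.transport (L.transport e h) g).2
    have h2 := hρ (L.transport e h).1 (UniversalCover.ofLoop 1) (L.transport e h).2
    simp only [deck_ofLoop, one_mul] at h1 h2
    refine Eq.trans ?_ h1.symm
    rw [L.coord_transport, ← h2, L.coord_transport]

instance (L : LocallyConstantBundle b₀ F p) :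
    ContinuousConstSMul (FundamentalGroup B b₀) L.Fibre where
  continuous_const_smul g := by
    change Continuous fun e : {e : E // p e = b₀} => (⟨(L.Φ.symm
      ((L.Φ ⟨(e.1, UniversalCover.ofLoop 1), e.2⟩).1, UniversalCover.ofLoop g)).1.1,
        L.proj_symm _ _⟩ : {e : E // p e = b₀})
    fun_prop

/-! #### The product of a locally constant bundle with itself -/

/-- The projection of `E ×_B E` to `B`. -/
def pairProj (p : E → B) (z : p.Pullback p) : B := p z.1.1

theorem isLocallyTrivialBundle_pair (hp : IsLocallyTrivialBundle F p) :
    IsLocallyTrivialBundle (F × F) (pairProj p) := by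
  obtain ⟨hc, ht⟩ := hp
  refine ⟨hc.comp (continuous_fst.comp continuous_subtype_val), fun b => ?_⟩
  obtain ⟨U, hU, hb, e, he⟩ := ht b
  have he2 : ∀ (u : U) (x : F), p (e.symm (u, x)).1 = u := fun u x => by
    have := he (e.symm (u, x))
    rw [Homeomorph.apply_symm_apply] at this
    exact (congrArg Subtype.val this).symm
  refine ⟨U, hU, hb,
    { toFun := fun z => (⟨p z.1.1.1, z.2⟩, ((e ⟨z.1.1.1, z.2⟩).2,
        (e ⟨z.1.1.2, Set.mem_preimage.2 (z.1.2 ▸ z.2)⟩).2))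
      invFun := fun y => ⟨⟨((e.symm (y.1, y.2.1)).1, (e.symm (y.1, y.2.2)).1), by
        rw [he2, he2]⟩, (e.symm (y.1, y.2.1)).2⟩
      left_inv := ?_
      right_inv := ?_
      continuous_toFun := by fun_prop
      continuous_invFun := by fun_prop }, fun z => rfl⟩
  · rintro ⟨⟨⟨x, y⟩, hxy⟩, hx⟩
    have key : ∀ (u : U) (x : E) (hx : p x ∈ U) (_ : p x = u),
        (e.symm (u, (e ⟨x, hx⟩).2)).1 = x := by
      intro u x hx hu
      have : (u, (e ⟨x, hx⟩).2) = e ⟨x, hx⟩ :=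
        Prod.ext ((Subtype.ext hu.symm).trans (he ⟨x, hx⟩).symm) rfl
      rw [this, Homeomorph.symm_apply_apply]
    refine Subtype.ext (Subtype.ext (Prod.ext ?_ ?_))
    · exact key _ _ _ rfl
    · exact key _ _ _ hxy.symm
  · rintro ⟨u, x, y⟩
    refine Prod.ext (Subtype.ext (he2 u x)) (Prod.ext ?_ ?_)
    · change (e (e.symm (u, x))).2 = x
      rw [Homeomorph.apply_symm_apply]
    · change (e (e.symm (u, y))).2 = y
      rw [Homeomorph.apply_symm_apply]

/-- The product `E ×_B E → B` as a locally constant bundle, with fibre `F × F`. -/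
noncomputable def pair (L : LocallyConstantBundle b₀ F p) :
    LocallyConstantBundle b₀ (F × F) (pairProj p) where
  locallyTrivial := isLocallyTrivialBundle_pair L.locallyTrivial
  Φ :=
    { toFun := fun z => (((L.Φ ⟨(z.1.1.1.1, z.1.2), z.2⟩).1,
        (L.Φ ⟨(z.1.1.1.2, z.1.2), z.1.1.2.symm.trans z.2⟩).1), z.1.2)
      invFun := fun y => ⟨(⟨((L.Φ.symm (y.1.1, y.2)).1.1, (L.Φ.symm (y.1.2, y.2)).1.1),
        (L.proj_symm _ _).trans (L.proj_symm _ _).symm⟩, y.2), L.proj_symm _ _⟩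
      left_inv := fun z => Subtype.ext (Prod.ext (Subtype.ext (Prod.ext
        (L.symm_apply_fst _ _ _) (L.symm_apply_fst _ _ _))) rfl)
      right_inv := fun y => Prod.ext (Prod.ext (L.coord_symm _ _) (L.coord_symm _ _)) rfl
      continuous_toFun := by fun_prop
      continuous_invFun := by fun_prop }
  Φ_snd _ := rfl
  constant_transition g := by
    obtain ⟨ρ, hρ⟩ := L.constant_transition g
    exact ⟨Prod.map ρ ρ, fun e a h => Prod.ext (hρ _ a h) (hρ _ a (e.2.symm.trans h))⟩

end LocallyConstantBundle

/-! ### Strict total orders -/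

open scoped SetRel in
/-- The axioms of a strict total order for a relation `R`, a subobject of the product `P` of an
object with itself. The underlying set of `P` is a set of pairs: all pairs for a space, the pairs
of points in the same fibre for a bundle. `SetRel.inv` is the opposite relation, `SetRel.id` is the
diagonal and `○` is composition. -/
structure IsStrictTotalOrderIn {X : Type*} (P R : SetRel X X) : Prop where
  subset : R ⊆ P
  transitive : R ○ R ⊆ R
  irreflexive : SetRel.id ∩ R = ∅
  antisymmetric : R ∩ R.inv = ∅
  total : R ∪ R.inv = P \ SetRel.id

/-- A `G`-space is orderable if there is a `G`-invariant subspace of `X × X` that satisfies the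
axioms of a strict total order. -/
def IsOrderableGSpace (G X : Type*) [Group G] [TopologicalSpace X] [MulAction G X]
    [ContinuousConstSMul G X] : Prop :=
  ∃ R : Set (X × X), (∀ (g : G), ∀ z ∈ R, g • z ∈ R) ∧ IsStrictTotalOrderIn Set.univ R

/-- A locally constant bundle is orderable if there is a locally constant sub-bundle `R` of
`E ×_B E` that satisfies the axioms of a strict total order. -/
def LocallyConstantBundle.IsOrderable {B E F : Type*} [TopologicalSpace B] [TopologicalSpace E]
    [TopologicalSpace F] {b₀ : B} {p : E → B} (L : LocallyConstantBundle b₀ F p) : Prop :=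
  ∃ R : Set (p.Pullback p), L.pair.IsSubbundle R ∧
    IsStrictTotalOrderIn {z : E × E | p z.1 = p z.2} (Subtype.val '' R)

/-! Through the trivialization over a point `a` of the universal cover, the fibre of `E` over the
image of `a` is identified with `F`, and passing from `a` to `g · a` changes the identification by
a self-map of `F` that depends only on `g`. Hence locally constant sub-bundles of `E` correspond to
the subsets of `F` that are invariant under this monodromy: a sub-bundle meets every fibre in the
same subset of `F`, and an invariant subset spreads out along the horizontal lifts. Applied to
`E ×_B E` this turns orderings of the bundle into invariant orderings of `F`. The fibre over `b₀` is
a copy of `F` on which `G` acts through the inverse of the monodromy, so its invariant orderings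
are those of `F` as well. -/

namespace UniversalCover

variable {B : Type*} [TopologicalSpace B] {b₀ : B}

theorem exists_toPath_trans_eq {b : B} (γ γ' : Path.Homotopic.Quotient b₀ b) :
    ∃ g : FundamentalGroup B b₀, (FundamentalGroup.toPath g).trans γ = γ' := by
  refine ⟨.fromPath (γ'.trans γ.symm), ?_⟩
  change (γ'.trans γ.symm).trans γ = γ'
  rw [Path.Homotopic.Quotient.trans_assoc, Path.Homotopic.Quotient.symm_trans,
    Path.Homotopic.Quotient.trans_refl]

theorem forall_trans_mem {x y z : B} {U : Set B} {η : Path x y} {ζ : Path y z}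
    (hη : ∀ t, η t ∈ U) (hζ : ∀ t, ζ t ∈ U) (t : unitInterval) : η.trans ζ t ∈ U := by
  have hrange : Set.range (η.trans ζ) ⊆ U := by
    rw [Path.trans_range]
    exact Set.union_subset (Set.range_subset_iff.2 hη) (Set.range_subset_iff.2 hζ)
  exact hrange ⟨t, rfl⟩

theorem homotopic_of_forall_loop_homotopic_refl {b x : B} {U : Set B}
    (hU : ∀ γ : Path b b, (∀ t, γ t ∈ U) → γ.Homotopic (Path.refl b)) {η ζ : Path b x}
    (hη : ∀ t, η t ∈ U) (hζ : ∀ t, ζ t ∈ U) : η.Homotopic ζ := by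
  have hloop := Path.Homotopic.Quotient.eq.2
    (hU (η.trans ζ.symm) (forall_trans_mem hη fun t => hζ _))
  rw [Path.Homotopic.Quotient.mk_trans, Path.Homotopic.Quotient.mk_symm,
    Path.Homotopic.Quotient.mk_refl] at hloop
  refine Path.Homotopic.Quotient.exact ?_
  calc Path.Homotopic.Quotient.mk η
      = ((Path.Homotopic.Quotient.mk η).trans (Path.Homotopic.Quotient.mk ζ).symm).trans
          (.mk ζ) := by
        rw [Path.Homotopic.Quotient.trans_assoc, Path.Homotopic.Quotient.symm_trans,
          Path.Homotopic.Quotient.trans_refl]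
    _ = .mk ζ := by rw [hloop, Path.Homotopic.Quotient.refl_trans]

section BasicNhd

variable {a c : UniversalCover b₀} {U V : Set B}

theorem mem_basicNhd_self (h : a.proj ∈ U) : a ∈ basicNhd a U :=
  ⟨.refl _, fun _ => h, by
    rw [Path.Homotopic.Quotient.mk_refl, Path.Homotopic.Quotient.trans_refl]⟩

theorem proj_mem_of_mem_basicNhd (h : c ∈ basicNhd a U) : c.proj ∈ U := by
  obtain ⟨η, hη, -⟩ := h
  simpa only [Path.target] using hη 1

theorem basicNhd_mono (h : U ⊆ V) : basicNhd a U ⊆ basicNhd a V :=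
  fun _ ⟨η, hη, hcls⟩ => ⟨η, fun t => h (hη t), hcls⟩

theorem basicNhd_subset_of_mem (h : c ∈ basicNhd a U) : basicNhd c U ⊆ basicNhd a U := by
  obtain ⟨η, hη, hc⟩ := h
  rintro d ⟨ζ, hζ, hd⟩
  exact ⟨η.trans ζ, forall_trans_mem hη hζ, by
    rw [hd, hc, Path.Homotopic.Quotient.mk_trans, Path.Homotopic.Quotient.trans_assoc]⟩

theorem isOpen_basicNhd (hU : IsOpen U) : IsOpen (basicNhd a U) :=
  .basic _ ⟨a, U, hU, rfl⟩

theorem isTopologicalBasis_basicNhd :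
    TopologicalSpace.IsTopologicalBasis {N | ∃ (a : UniversalCover b₀) (U : Set B),
      IsOpen U ∧ N = basicNhd a U} where
  exists_subset_inter := by
    rintro _ ⟨a, U, hU, rfl⟩ _ ⟨a', V, hV, rfl⟩ c ⟨hc, hc'⟩
    refine ⟨basicNhd c (U ∩ V), ⟨c, U ∩ V, hU.inter hV, rfl⟩, mem_basicNhd_self
      ⟨proj_mem_of_mem_basicNhd hc, proj_mem_of_mem_basicNhd hc'⟩, Set.subset_inter ?_ ?_⟩
    · exact (basicNhd_mono Set.inter_subset_left).trans (basicNhd_subset_of_mem hc)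
    · exact (basicNhd_mono Set.inter_subset_right).trans (basicNhd_subset_of_mem hc')
  sUnion_eq := Set.eq_univ_of_forall fun a =>
    ⟨basicNhd a Set.univ, ⟨a, Set.univ, isOpen_univ, rfl⟩, mem_basicNhd_self (Set.mem_univ _)⟩
  eq_generateFrom := rfl

theorem image_proj_basicNhd (a : UniversalCover b₀) (U : Set B) :
    proj '' basicNhd a U = pathComponentIn U a.proj := by
  ext x
  constructor
  · rintro ⟨c, ⟨η, hη, -⟩, rfl⟩
    exact ⟨η, hη⟩
  · rintro ⟨η, hη⟩
    exact ⟨⟨x, a.cls.trans (.mk η)⟩, ⟨η, hη, rfl⟩, rfl⟩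

theorem isOpenMap_proj [LocallyPathConnectedSpace B] :
    IsOpenMap (proj : UniversalCover b₀ → B) := by
  refine isTopologicalBasis_basicNhd.isOpenMap_iff.2 ?_
  rintro _ ⟨a, U, hU, rfl⟩
  rw [image_proj_basicNhd]
  exact hU.pathComponentIn _

theorem injOn_proj_basicNhd
    (hU : ∀ γ : Path a.proj a.proj, (∀ t, γ t ∈ U) → γ.Homotopic (Path.refl a.proj)) :
    Set.InjOn proj (basicNhd a U) := by
  rintro ⟨x, γ⟩ ⟨η, hη, hγ⟩ ⟨_, γ'⟩ ⟨η', hη', hγ'⟩ h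
  obtain rfl : x = _ := h
  have hηη' : Path.Homotopic.Quotient.mk η = .mk η' :=
    Path.Homotopic.Quotient.eq.2 (homotopic_of_forall_loop_homotopic_refl hU hη hη')
  have hcls : γ = γ' := hγ.trans ((congrArg a.cls.trans hηη').trans hγ'.symm)
  exact congrArg (UniversalCover.mk x) hcls

end BasicNhd

theorem exists_continuous_section [LocallyPathConnectedSpace B]
    [SemilocallySimplyConnectedSpace B] (a : UniversalCover b₀) :
    ∃ U : Set B, IsOpen U ∧ a.proj ∈ U ∧ ∃ s : U → UniversalCover b₀, Continuous s ∧
      ∀ u, (s u).proj = u := by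
  obtain ⟨V, hV, hloop⟩ := SemilocallySimplyConnectedSpace.exists_nhds a.proj
  obtain ⟨W, hWV, hW, haW⟩ := mem_nhds_iff.1 hV
  have hinj : Set.InjOn proj (basicNhd a W) :=
    injOn_proj_basicNhd fun γ hγ => hloop γ fun t => hWV (hγ t)
  have : Nonempty (UniversalCover b₀) := ⟨a⟩
  have hcont : ContinuousOn (Function.invFunOn proj (basicNhd a W)) (proj '' basicNhd a W) :=
    (isOpenMap_proj.domRestrict (isOpen_basicNhd hW)).continuousOn_image_of_leftInvOn
      hinj.leftInvOn_invFunOn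
  exact ⟨proj '' basicNhd a W, isOpenMap_proj _ (isOpen_basicNhd hW),
    ⟨a, mem_basicNhd_self haW, rfl⟩, _, hcont.domRestrict, fun u => Function.invFunOn_eq u.2⟩

end UniversalCover

theorem IsLocallyTrivialBundle.of_pullback {B E F Y : Type*} [TopologicalSpace B]
    [TopologicalSpace E] [TopologicalSpace F] [TopologicalSpace Y] {p : E → B} {q : Y → B}
    (hp : Continuous p)
    (hq : ∀ b, ∃ U : Set B, IsOpen U ∧ b ∈ U ∧ ∃ s : U → Y, Continuous s ∧ ∀ u, q (s u) = u)
    (Φ : p.Pullback q ≃ₜ F × Y) (hΦ : ∀ z, (Φ z).2 = z.1.2) : IsLocallyTrivialBundle F p := by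
  refine ⟨hp, fun b => ?_⟩
  obtain ⟨U, hU, hb, s, hs, hqs⟩ := hq b
  have symm_snd (x : F) (y : Y) : (Φ.symm (x, y)).1.2 = y := by
    rw [← hΦ, Homeomorph.apply_symm_apply]
  have proj_symm (x : F) (u : U) : p (Φ.symm (x, s u)).1.1 = u := by
    rw [(Φ.symm (x, s u)).2, symm_snd, hqs]
  let lift (e : p ⁻¹' U) : p.Pullback q := ⟨(e, s ⟨p e, e.2⟩), (hqs ⟨p e, e.2⟩).symm⟩
  have lift_symm (x : F) (u : U) (h : p (Φ.symm (x, s u)).1.1 ∈ U) :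
      lift ⟨(Φ.symm (x, s u)).1.1, h⟩ = Φ.symm (x, s u) :=
    Subtype.ext (Prod.ext rfl ((congrArg s (Subtype.ext (proj_symm x u))).trans
      (symm_snd x (s u)).symm))
  have symm_lift (e : p ⁻¹' U) : Φ.symm ((Φ (lift e)).1, s ⟨p e, e.2⟩) = lift e := by
    rw [Homeomorph.symm_apply_eq]
    exact Prod.ext rfl (hΦ (lift e)).symm
  exact ⟨U, hU, hb,
    { toFun := fun e => (⟨p e, e.2⟩, (Φ (lift e)).1)
      invFun := fun y => ⟨(Φ.symm (y.2, s y.1)).1.1,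
        Set.mem_preimage.2 (Set.mem_of_eq_of_mem (proj_symm y.2 y.1) y.1.2)⟩
      left_inv := fun e => Subtype.ext (congrArg (fun z => z.1.1) (symm_lift e))
      right_inv := fun y => Prod.ext (Subtype.ext (proj_symm y.2 y.1)) (by
        dsimp only
        rw [lift_symm, Homeomorph.apply_symm_apply])
      continuous_toFun := by fun_prop
      continuous_invFun := by fun_prop }, fun _ => rfl⟩

section StrictTotalOrder

variable {X Y B : Type*}

theorem isStrictTotalOrderIn_iff {P R : SetRel X X} [P.IsSymm] :
    IsStrictTotalOrderIn P R ↔ R ⊆ P ∧ R.IsIrrefl ∧ R.IsTrans ∧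
      ∀ x y, (x, y) ∈ P → x ≠ y → (x, y) ∈ R ∨ (y, x) ∈ R := by
  constructor
  · rintro ⟨hsub, htrans, hirrefl, -, htotal⟩
    exact ⟨hsub, ⟨fun x hx => hirrefl.subset ⟨rfl, hx⟩⟩,
      SetRel.isTrans_iff_comp_subset_self.2 htrans,
      fun x y hxy hne => htotal.superset ⟨hxy, hne⟩⟩
  · rintro ⟨hsub, hirrefl, htrans, htotal⟩
    have hne {x y : X} (h : (x, y) ∈ R) : x ≠ y := by
      rintro rfl
      exact R.irrefl x h
    refine ⟨hsub, SetRel.comp_subset_self, ?_, ?_, ?_⟩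
    · exact Set.eq_empty_of_forall_notMem fun z hz => hne hz.2 hz.1
    · exact Set.eq_empty_of_forall_notMem fun z hz => R.irrefl z.1 (R.trans hz.1 hz.2)
    · refine Set.Subset.antisymm ?_ fun z hz => htotal z.1 z.2 hz.1 hz.2
      rintro ⟨x, y⟩ (h | h)
      · exact ⟨hsub h, hne h⟩
      · exact ⟨P.symm (hsub h), (hne h).symm⟩

theorem isStrictTotalOrderIn_univ_iff {R : SetRel X X} :
    IsStrictTotalOrderIn Set.univ R ↔ IsStrictTotalOrder X fun x y => (x, y) ∈ R := by
  rw [isStrictTotalOrderIn_iff]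
  constructor
  · rintro ⟨-, hirrefl, htrans, htotal⟩
    exact
      { irrefl := hirrefl.irrefl
        trans := htrans.trans
        trichotomous := fun x y hxy hyx =>
          by_contra fun hne => (htotal x y (Set.mem_univ _) hne).elim hxy hyx }
  · intro h
    refine ⟨Set.subset_univ R, h.toIrrefl, h.toIsTrans, fun x y _ hne => ?_⟩
    by_contra! hxy
    exact hne (h.trichotomous x y hxy.1 hxy.2)

theorem isStrictTotalOrderIn_fibreProduct_iff {p : X → B} {R : SetRel X X} :
    IsStrictTotalOrderIn {z | p z.1 = p z.2} R ↔ R ⊆ {z | p z.1 = p z.2} ∧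
      ∀ b, IsStrictTotalOrder {x // p x = b} fun x y => (x.1, y.1) ∈ R := by
  have : SetRel.IsSymm {z : X × X | p z.1 = p z.2} := ⟨fun _ _ => Eq.symm⟩
  rw [isStrictTotalOrderIn_iff, and_congr_right_iff]
  intro hsub
  constructor
  · rintro ⟨hirrefl, htrans, htotal⟩ b
    exact
      { irrefl := fun x => hirrefl.irrefl x.1
        trans := fun x y z => htrans.trans x.1 y.1 z.1
        trichotomous := fun x y hxy hyx => by_contra fun hne =>
          (htotal x y (x.2.trans y.2.symm) (hne ∘ Subtype.ext)).elim hxy hyx }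
  · intro h
    refine ⟨⟨fun x => (h (p x)).irrefl ⟨x, rfl⟩⟩, ⟨fun x y z hxy hyz => ?_⟩,
      fun x y hxy hne => ?_⟩
    · have hyx : p y = p x := (hsub hxy).symm
      have hzx : p z = p x := (hsub hyz).symm.trans hyx
      exact (h (p x)).trans ⟨x, rfl⟩ ⟨y, hyx⟩ ⟨z, hzx⟩ hxy hyz
    · by_contra! hR
      exact hne (congrArg Subtype.val
        ((h (p x)).trichotomous ⟨x, rfl⟩ ⟨y, Eq.symm hxy⟩ hR.1 hR.2))

theorem isStrictTotalOrder_congr (e : X ≃ Y) {r : X → X → Prop} {s : Y → Y → Prop}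
    (h : ∀ x y, r x y ↔ s (e x) (e y)) : IsStrictTotalOrder X r ↔ IsStrictTotalOrder Y s :=
  let f : r ≃r s := ⟨e, (h _ _).symm⟩
  ⟨fun _ => f.symm.toRelEmbedding.isStrictTotalOrder, fun _ => f.toRelEmbedding.isStrictTotalOrder⟩

end StrictTotalOrder

namespace LocallyConstantBundle

universe u v w

variable {B : Type u} {E : Type v} {F : Type w} [TopologicalSpace B] [TopologicalSpace E]
  [TopologicalSpace F] {b₀ : B} {p : E → B}

/-- The `F`-coordinate on the fibre over `b`, as read off from the trivialization at the point `γ`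
of the universal cover over `b`. -/
noncomputable def fibreEquiv (L : LocallyConstantBundle b₀ F p) {b : B}
    (γ : Path.Homotopic.Quotient b₀ b) : {e // p e = b} ≃ F where
  toFun e := (L.Φ ⟨(e.1, ⟨b, γ⟩), e.2⟩).1
  invFun x := ⟨(L.Φ.symm (x, ⟨b, γ⟩)).1.1, L.proj_symm x ⟨b, γ⟩⟩
  left_inv _ := Subtype.ext (L.symm_apply_fst _ _ _)
  right_inv x := L.coord_symm x ⟨b, γ⟩

/-- The monodromy of `g`: the transition function `ρ` of the deck transformation `g`, computed over
the class of the constant loop. -/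
noncomputable def monodromy (L : LocallyConstantBundle b₀ F p) (g : FundamentalGroup B b₀) :
    Equiv.Perm F :=
  (L.fibreEquiv (.refl b₀)).symm.trans (L.fibreEquiv (FundamentalGroup.toPath g))

theorem monodromy_fibreEquiv (L : LocallyConstantBundle b₀ F p) (g : FundamentalGroup B b₀)
    {b : B} (γ : Path.Homotopic.Quotient b₀ b) (e : {e // p e = b}) :
    L.monodromy g (L.fibreEquiv γ e) =
      L.fibreEquiv ((FundamentalGroup.toPath g).trans γ) e := by
  obtain ⟨ρ, hρ⟩ := L.constant_transition g
  have fibreEquiv_trans {c : B} (δ : Path.Homotopic.Quotient b₀ c) (x : {e // p e = c}) :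
      L.fibreEquiv ((FundamentalGroup.toPath g).trans δ) x = ρ (L.fibreEquiv δ x) :=
    hρ x.1 ⟨c, δ⟩ x.2
  have monodromy_apply (x : F) : L.monodromy g x = ρ x := by
    have hx := fibreEquiv_trans (.refl b₀) ((L.fibreEquiv (.refl b₀)).symm x)
    rwa [Path.Homotopic.Quotient.trans_refl, Equiv.apply_symm_apply] at hx
  rw [monodromy_apply, fibreEquiv_trans]

theorem monodromy_fibreEquiv_smul (L : LocallyConstantBundle b₀ F p)
    (g : FundamentalGroup B b₀) (x : L.Fibre) :
    L.monodromy g (L.fibreEquiv (.refl b₀) (g • x)) = L.fibreEquiv (.refl b₀) x := by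
  refine (L.monodromy_fibreEquiv g (.refl b₀) (g • x)).trans ?_
  rw [Path.Homotopic.Quotient.trans_refl]
  exact L.coord_transport x g

/-- The subset `S` of the fibre is preserved by the monodromy. -/
def IsMonodromyInvariant (L : LocallyConstantBundle b₀ F p) (S : Set F) : Prop :=
  ∀ g x, L.monodromy g x ∈ S ↔ x ∈ S

/-- The subset `R` of `E` meets each fibre in the subset `S` of `F`. The `F`-coordinate of a point
depends on the choice of a point `γ` of the universal cover, and the condition is imposed for every
choice. -/
def IsModelledOn (L : LocallyConstantBundle b₀ F p) (R : Set E) (S : Set F) : Prop :=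
  ∀ ⦃b : B⦄ (γ : Path.Homotopic.Quotient b₀ b) (e : {e // p e = b}),
    e.1 ∈ R ↔ L.fibreEquiv γ e ∈ S

section Subbundle

variable {L : LocallyConstantBundle b₀ F p} {R : Set E} {S : Set F}

theorem IsModelledOn.isMonodromyInvariant (h : L.IsModelledOn R S) :
    L.IsMonodromyInvariant S := by
  intro g x
  obtain ⟨e, rfl⟩ := (L.fibreEquiv (.refl b₀)).surjective x
  rw [monodromy_fibreEquiv, ← h, ← h]

theorem IsMonodromyInvariant.exists_isModelledOn (hS : L.IsMonodromyInvariant S) :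
    ∃ R, L.IsModelledOn R S := by
  refine ⟨{e | ∃ γ : Path.Homotopic.Quotient b₀ (p e), L.fibreEquiv γ ⟨e, rfl⟩ ∈ S}, ?_⟩
  rintro _ γ ⟨e, rfl⟩
  refine ⟨?_, fun he => ⟨γ, he⟩⟩
  rintro ⟨γ', he⟩
  obtain ⟨g, rfl⟩ := UniversalCover.exists_toPath_trans_eq γ' γ
  rwa [← hS g, monodromy_fibreEquiv] at he

theorem IsSubbundle.exists_isModelledOn (hR : L.IsSubbundle R) : ∃ S, L.IsModelledOn R S := by
  obtain ⟨F', _, L', -, _, k, -, hk⟩ := hR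
  have fibreEquiv_val {b : B} (γ : Path.Homotopic.Quotient b₀ b) (r : {r : R // p r = b}) :
      L.fibreEquiv γ ⟨r.1, r.2⟩ = k (L'.fibreEquiv γ r) :=
    congrArg Prod.fst (hk ⟨(r.1, ⟨b, γ⟩), r.2⟩)
  refine ⟨Set.range k, fun b γ e => ⟨fun he => ⟨_, (fibreEquiv_val γ ⟨⟨e.1, he⟩, e.2⟩).symm⟩, ?_⟩⟩
  rintro ⟨x, hx⟩
  obtain ⟨r, rfl⟩ := (L'.fibreEquiv γ).surjective x
  rw [← fibreEquiv_val] at hx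
  exact (L.fibreEquiv γ).injective hx ▸ r.1.2

/-- The trivialization of the pull-back of `R`, obtained by restricting that of `E`. -/
noncomputable def IsModelledOn.trivialization (h : L.IsModelledOn R S) :
    (fun e : R => p e).Pullback (UniversalCover.proj (b₀ := b₀)) ≃ₜ S × UniversalCover b₀ where
  toFun z := (⟨(L.Φ ⟨(z.1.1, z.1.2), z.2⟩).1, (h z.1.2.cls ⟨z.1.1, z.2⟩).1 z.1.1.2⟩, z.1.2)
  invFun y := ⟨(⟨(L.Φ.symm (y.1, y.2)).1.1, (h y.2.cls ⟨_, L.proj_symm y.1 y.2⟩).2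
    (Set.mem_of_eq_of_mem (L.coord_symm y.1 y.2) y.1.2)⟩, y.2), L.proj_symm y.1 y.2⟩
  left_inv _ := Subtype.ext (Prod.ext (Subtype.ext (L.symm_apply_fst _ _ _)) rfl)
  right_inv _ := Prod.ext (Subtype.ext (L.coord_symm _ _)) rfl
  continuous_toFun := by fun_prop
  continuous_invFun := by fun_prop

variable [PathConnectedSpace B] [LocallyPathConnectedSpace B] [SemilocallySimplyConnectedSpace B]

/-- The locally constant bundle structure with fibre `S` on a subspace modelled on `S`. -/
noncomputable def IsModelledOn.restrict (h : L.IsModelledOn R S) :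
    LocallyConstantBundle b₀ S (fun e : R => p e) where
  locallyTrivial := .of_pullback (L.locallyTrivial.1.comp continuous_subtype_val)
    (fun b => UniversalCover.exists_continuous_section
      ⟨b, .mk (PathConnectedSpace.somePath b₀ b)⟩)
    h.trivialization fun _ => rfl
  Φ := h.trivialization
  Φ_snd _ := rfl
  constant_transition g :=
    ⟨fun x => ⟨L.monodromy g x, (h.isMonodromyInvariant g x).2 x.2⟩,
      fun e a he => Subtype.ext (L.monodromy_fibreEquiv g a.cls ⟨e, he⟩).symm⟩

theorem IsModelledOn.isSubbundle (h : L.IsModelledOn R S) : L.IsSubbundle R :=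
  ⟨S, inferInstance, h.restrict, continuous_subtype_val, fun _ => rfl, Subtype.val,
    continuous_subtype_val, fun _ => Prod.ext rfl (L.Φ_snd _)⟩

end Subbundle

theorem IsModelledOn.isStrictTotalOrderIn_iff [PathConnectedSpace B]
    {L : LocallyConstantBundle b₀ F p} {R : Set (p.Pullback p)} {S : Set (F × F)}
    (h : L.pair.IsModelledOn R S) :
    IsStrictTotalOrderIn {z : E × E | p z.1 = p z.2} (Subtype.val '' R) ↔
      IsStrictTotalOrderIn Set.univ S := by
  have hfibre {b : B} (γ : Path.Homotopic.Quotient b₀ b) :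
      (IsStrictTotalOrder {e // p e = b} fun x y => (x.1, y.1) ∈ Subtype.val '' R) ↔
        IsStrictTotalOrderIn Set.univ S := by
    rw [isStrictTotalOrderIn_univ_iff]
    refine isStrictTotalOrder_congr (L.fibreEquiv γ) fun x y => ?_
    have hxy : p x.1 = p y.1 := x.2.trans y.2.symm
    exact (Subtype.val_injective.mem_set_image (a := ⟨(x.1, y.1), hxy⟩)).trans
      (h γ ⟨⟨(x.1, y.1), hxy⟩, x.2⟩)
  have hsub : Subtype.val '' R ⊆ {z : E × E | p z.1 = p z.2} := Subtype.coe_image_subset _ R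
  rw [isStrictTotalOrderIn_fibreProduct_iff, and_iff_right hsub]
  exact ⟨fun hR => (hfibre (.refl b₀)).1 (hR b₀),
    fun hS b => (hfibre (.mk (PathConnectedSpace.somePath b₀ b))).2 hS⟩

theorem isOrderable_iff_exists_isMonodromyInvariant [PathConnectedSpace B]
    [LocallyPathConnectedSpace B] [SemilocallySimplyConnectedSpace B]
    (L : LocallyConstantBundle b₀ F p) :
    L.IsOrderable ↔ ∃ S : Set (F × F), L.pair.IsMonodromyInvariant S ∧
      IsStrictTotalOrderIn Set.univ S := by
  constructor
  · rintro ⟨R, hsub, hR⟩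
    obtain ⟨S, h⟩ := hsub.exists_isModelledOn
    exact ⟨S, h.isMonodromyInvariant, h.isStrictTotalOrderIn_iff.1 hR⟩
  · rintro ⟨S, hinv, hS⟩
    obtain ⟨R, h⟩ := hinv.exists_isModelledOn
    exact ⟨R, h.isSubbundle, h.isStrictTotalOrderIn_iff.2 hS⟩

/-- The `F × F`-coordinates of a pair of points of the fibre over the base point. -/
noncomputable def fibrePairEquiv (L : LocallyConstantBundle b₀ F p) :
    L.Fibre × L.Fibre ≃ F × F :=
  (L.fibreEquiv (.refl b₀)).prodCongr (L.fibreEquiv (.refl b₀))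

theorem monodromy_fibrePairEquiv_smul (L : LocallyConstantBundle b₀ F p)
    (g : FundamentalGroup B b₀) (z : L.Fibre × L.Fibre) :
    L.pair.monodromy g (L.fibrePairEquiv (g • z)) = L.fibrePairEquiv z :=
  Prod.ext (L.monodromy_fibreEquiv_smul g z.1) (L.monodromy_fibreEquiv_smul g z.2)

theorem forall_smul_mem_preimage_iff_isMonodromyInvariant (L : LocallyConstantBundle b₀ F p)
    (S : Set (F × F)) :
    (∀ g : FundamentalGroup B b₀, ∀ z ∈ L.fibrePairEquiv ⁻¹' S, g • z ∈ L.fibrePairEquiv ⁻¹' S) ↔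
      L.pair.IsMonodromyInvariant S := by
  constructor
  · intro h g x
    obtain ⟨z, rfl⟩ := L.fibrePairEquiv.surjective x
    obtain ⟨z, rfl⟩ := MulAction.surjective g z
    rw [monodromy_fibrePairEquiv_smul]
    exact ⟨h g z, fun hz => by simpa only [Set.mem_preimage, inv_smul_smul] using h g⁻¹ _ hz⟩
  · intro h g z hz
    rwa [Set.mem_preimage, ← h g, monodromy_fibrePairEquiv_smul]

theorem isOrderableGSpace_fibre_iff_exists_isMonodromyInvariant
    (L : LocallyConstantBundle b₀ F p) :
    IsOrderableGSpace (FundamentalGroup B b₀) L.Fibre ↔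
      ∃ S : Set (F × F), L.pair.IsMonodromyInvariant S ∧ IsStrictTotalOrderIn Set.univ S := by
  refine L.fibrePairEquiv.injective.preimage_surjective.exists.trans (exists_congr fun S =>
    and_congr (L.forall_smul_mem_preimage_iff_isMonodromyInvariant S) ?_)
  rw [isStrictTotalOrderIn_univ_iff, isStrictTotalOrderIn_univ_iff]
  exact isStrictTotalOrder_congr (L.fibreEquiv (.refl b₀)) fun _ _ => Iff.rfl

end LocallyConstantBundle

theorem proposition3p7 {B E F : Type*} [TopologicalSpace B] [TopologicalSpace E]
    [TopologicalSpace F] [PathConnectedSpace B] [LocallyPathConnectedSpace B]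
    [SemilocallySimplyConnectedSpace B] (b₀ : B) (p : E → B)
    (L : LocallyConstantBundle b₀ F p) :
    L.IsOrderable ↔ IsOrderableGSpace (FundamentalGroup B b₀) L.Fibre :=
  L.isOrderable_iff_exists_isMonodromyInvariant.trans
    L.isOrderableGSpace_fibre_iff_exists_isMonodromyInvariant.symm
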